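/- Norms are Euclidean. For a function $h:\mathbb{R}^N\to\mathbb{R}^M$, a point $x\in\mathbb{R}^N$ and $\epsilon>0$ put $$\alpha(\epsilon)=\sup_{\|w\|\le\epsilon}\|h(x+w)-h(x)\|,\qquad \beta(o,\epsilon)=\|h(x+\epsilon o)-h(x)\|,$$ where $o$ is uniformly distributed on the unit sphere of $\mathbb{R}^N$, and let $E_o$ denote the expectation over $o$. It is assumed throughout that $o\mapsto\beta(o,\epsilon)$ is measurable for all sufficiently small $\epsilon>0$. When we say below that the limit of $\alpha(\epsilon)/E_o\{\beta(o,\epsilon)\}$ exists, this includes that for all sufficiently small $\epsilon>0$ one has $\alpha(\epsilon)<\infty$ and $0<E_o\{\beta(o,\epsilon)\}<\infty$. (1) Let $h:\mathbb{R}^N\to\mathbb{R}^M$ be differentiable at $x$ with nonzero Jacobian matrix $\nabla h(x)\in\mathbb{R}^{M\times N}$. Then the following limit exists and satisfies $$\lim_{\epsilon\to0^+}\frac{\alpha(\epsilon)}{E_o\{\beta(o,\epsilon)\}}\ \ge\ \sqrt{\frac NM}.$$ (2) For all $\delta>0$ and $\eta>0$ there is $N_0=N_0(\delta,\eta)$ such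 that for all $N\ge N_0$ and all $M\ge1$ the following holds. Let $x\in\mathbb{R}^N$ and let $h:\mathbb{R}^N\to\mathbb{R}^M$ be a random function that is almost surely differentiable at $x$ and whose Jacobian matrix $\nabla h(x)$ has i.i.d. standard Gaussian $\mathcal N(0,1)$ entries. Then, with probability at least $1-\eta$, the following limit exists and satisfies $$\lim_{\epsilon\to0^+}\frac{\alpha(\epsilon)}{E_o\{\beta(o,\epsilon)\}}\ \ge\ (1-\delta)\sqrt{\frac{N+M}{M}}.$$ -/

import Mathlib

open MeasureTheory ProbabilityTheory Filter Topology

noncomputable section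

/-- The uniform distribution on the unit sphere of `ℝ^N`: the surface measure induced by Lebesgue
measure, normalised to total mass one (for `N ≥ 1`). -/
def uniformSphere (N : ℕ) :
    Measure (Metric.sphere (0 : EuclideanSpace ℝ (Fin N)) 1) :=
  ((volume : Measure (EuclideanSpace ℝ (Fin N))).toSphere Set.univ)⁻¹ •
    (volume : Measure (EuclideanSpace ℝ (Fin N))).toSphere

theorem isProbabilityMeasure_uniformSphere {N : ℕ} (hN : 1 ≤ N) :
    IsProbabilityMeasure (uniformSphere N) := by
  refine ⟨?_⟩
  rw [uniformSphere, Measure.smul_apply, smul_eq_mul]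
  refine ENNReal.inv_mul_cancel ?_ (measure_ne_top _ _)
  rw [Measure.measure_univ_ne_zero, Ne, Measure.toSphere_eq_zero_iff_finrank]
  rw [finrank_euclideanSpace_fin]
  omega

/-- The set of changes `‖h (x + w) - h x‖` of `h` over all perturbations `‖w‖ ≤ ε`. -/
def changes {N M : ℕ} (h : EuclideanSpace ℝ (Fin N) → EuclideanSpace ℝ (Fin M))
    (x : EuclideanSpace ℝ (Fin N)) (ε : ℝ) : Set ℝ :=
  {r | ∃ w : EuclideanSpace ℝ (Fin N), ‖w‖ ≤ ε ∧ r = ‖h (x + w) - h x‖}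

/-- `α(ε)`: the worst-case change of `h` at `x` over perturbations of norm at most `ε`. -/
def worstChange {N M : ℕ} (h : EuclideanSpace ℝ (Fin N) → EuclideanSpace ℝ (Fin M))
    (x : EuclideanSpace ℝ (Fin N)) (ε : ℝ) : ℝ :=
  sSup (changes h x ε)

/-- `β(o, ε)`: the change of `h` at `x` under the perturbation `ε o`, `o` a unit vector. -/
def directionalChange {N M : ℕ} (h : EuclideanSpace ℝ (Fin N) → EuclideanSpace ℝ (Fin M))
    (x : EuclideanSpace ℝ (Fin N)) (o : Metric.sphere (0 : EuclideanSpace ℝ (Fin N)) 1)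
    (ε : ℝ) : ℝ :=
  ‖h (x + ε • (o : EuclideanSpace ℝ (Fin N))) - h x‖

/-- `E_o β(o, ε)` for `o` uniformly distributed on the unit sphere. -/
def expectedChange {N M : ℕ} (h : EuclideanSpace ℝ (Fin N) → EuclideanSpace ℝ (Fin M))
    (x : EuclideanSpace ℝ (Fin N)) (ε : ℝ) : ℝ :=
  ∫ o, directionalChange h x o ε ∂(uniformSphere N)

/-- For all small `ε > 0`, the random variable `o ↦ β(o, ε)` is measurable
(so that its expectation is meaningful). -/
def MeasurableChange {N M : ℕ} (h : EuclideanSpace ℝ (Fin N) → EuclideanSpace ℝ (Fin M))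
    (x : EuclideanSpace ℝ (Fin N)) : Prop :=
  ∀ᶠ ε in 𝓝[>] (0 : ℝ), AEMeasurable (fun o ↦ directionalChange h x o ε) (uniformSphere N)

/-- The Jacobian matrix of `h` at `x`: the entry `(i, j)` is `∂h_i/∂x_j`. -/
def jacobian {N M : ℕ} (h : EuclideanSpace ℝ (Fin N) → EuclideanSpace ℝ (Fin M))
    (x : EuclideanSpace ℝ (Fin N)) : Matrix (Fin M) (Fin N) ℝ :=
  Matrix.of fun i j ↦ (fderiv ℝ h x (EuclideanSpace.single j 1)) i

/-- `lim_{ε → 0+} α(ε) / E_o β(o, ε)` exists and is at least `c`. The first part says that for all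
small `ε > 0` the quotient is a genuine one: `α(ε)` is finite, `E_o β(o, ε)` exists and is
positive. -/
def LimitRatioAtLeast {N M : ℕ} (h : EuclideanSpace ℝ (Fin N) → EuclideanSpace ℝ (Fin M))
    (x : EuclideanSpace ℝ (Fin N)) (c : ℝ) : Prop :=
  (∀ᶠ ε in 𝓝[>] (0 : ℝ), BddAbove (changes h x ε) ∧
      Integrable (fun o ↦ directionalChange h x o ε) (uniformSphere N) ∧
      0 < expectedChange h x ε) ∧
    ∃ L : ℝ, Tendsto (fun ε ↦ worstChange h x ε / expectedChange h x ε) (𝓝[>] (0 : ℝ)) (𝓝 L) ∧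
      c ≤ L

end

/-! Write J for the Jacobian, with rows a_i. By differentiability, α(ε)/ε tends to the operator norm
‖J‖ and E β(o, ε)/ε to E‖Jo‖, so the limit is ‖J‖ / E‖Jo‖. Rotation invariance gives E⟨a, o⟩² =
‖a‖²/N, hence (E‖Jo‖)² ≤ ∑‖a_i‖²/N. The ratio is therefore at least √N ‖J‖ / √(∑‖a_i‖²), which is
`limitRatioAtLeast_of_le`.

For (1), every row satisfies ‖a_i‖ ≤ ‖J‖.

For (2), testing J on its own row a_0 gives ‖J‖² ≥ ‖a_0‖² + ∑_{i≠0} ⟨a_i, a_0⟩²/‖a_0‖². The first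
term concentrates near N; given a_0, the second is a sum of M - 1 squared standard Gaussians. So
‖J‖² is at least about N + M, while ∑‖a_i‖² is about NM. Chebyshev's inequality controls all three
quantities with errors that vanish as N grows, uniformly in M. -/

/-! ### Rotation invariance and second moments on the sphere -/

/-- The surface measure of a set is N times the volume of the cone over it; an isometry preserves
volume and carries cones to cones. -/
theorem toSphere_map_linearIsometryEquiv {N : ℕ}
    (U : EuclideanSpace ℝ (Fin N) ≃ₗᵢ[ℝ] EuclideanSpace ℝ (Fin N)) :
    (volume : Measure (EuclideanSpace ℝ (Fin N))).toSphere.map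
      (fun o ↦ ⟨U o, by simp⟩) = (volume : Measure (EuclideanSpace ℝ (Fin N))).toSphere := by
  ext s hs
  have hm : Measurable (fun o : Metric.sphere (0 : EuclideanSpace ℝ (Fin N)) 1 ↦
      (⟨U o, by simp⟩ : Metric.sphere (0 : EuclideanSpace ℝ (Fin N)) 1)) :=
    Continuous.measurable (by fun_prop)
  rw [Measure.map_apply hm hs, Measure.toSphere_apply' _ (hm hs), Measure.toSphere_apply' _ hs]
  congr 1
  symm
  rw [← U.measurePreserving.measure_preimage_emb U.toHomeomorph.measurableEmbedding]
  congr 1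
  symm
  ext y
  simp only [Set.mem_smul, Set.mem_image, Set.mem_preimage]
  constructor
  · rintro ⟨r, hr, _, ⟨o, ho, rfl⟩, rfl⟩
    exact ⟨r, hr, _, ⟨_, ho, rfl⟩, by simp⟩
  · rintro ⟨r, hr, _, ⟨o, ho, rfl⟩, hy⟩
    refine ⟨r, hr, _, ⟨⟨U.symm o, by simp⟩, by simpa using ho, rfl⟩, ?_⟩
    apply U.injective
    simpa using hy

theorem integral_uniformSphere_comp_linearIsometryEquiv {N : ℕ}
    (U : EuclideanSpace ℝ (Fin N) ≃ₗᵢ[ℝ] EuclideanSpace ℝ (Fin N))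
    {f : EuclideanSpace ℝ (Fin N) → ℝ} (hf : Continuous f) :
    ∫ o, f (U o) ∂(uniformSphere N) = ∫ o, f o ∂(uniformSphere N) := by
  have hm : Continuous (fun o : Metric.sphere (0 : EuclideanSpace ℝ (Fin N)) 1 ↦
      (⟨U o, by simp⟩ : Metric.sphere (0 : EuclideanSpace ℝ (Fin N)) 1)) := by fun_prop
  have h : (uniformSphere N).map (fun o ↦ ⟨U o, by simp⟩) = uniformSphere N := by
    rw [uniformSphere, Measure.map_smul, toSphere_map_linearIsometryEquiv]
  conv_rhs => rw [← h]
  rw [integral_map hm.measurable.aemeasurable (by fun_prop)]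

theorem integrable_uniformSphere {N : ℕ} (hN : 1 ≤ N)
    {f : Metric.sphere (0 : EuclideanSpace ℝ (Fin N)) 1 → ℝ} (hf : Continuous f) :
    Integrable f (uniformSphere N) := by
  have := isProbabilityMeasure_uniformSphere hN
  exact hf.integrable_of_hasCompactSupport (HasCompactSupport.of_compactSpace f)

/-- By invariance `a` may be replaced by `‖a‖ e_j` for each `j`; summing over `j` and using `∑ o_j²
= 1` fixes the constant. -/
theorem integral_inner_sq_uniformSphere {N : ℕ} (hN : 1 ≤ N) (a : EuclideanSpace ℝ (Fin N)) :
    ∫ o, (inner ℝ a (o : EuclideanSpace ℝ (Fin N))) ^ 2 ∂(uniformSphere N) = ‖a‖ ^ 2 / N := by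
  have := isProbabilityMeasure_uniformSphere hN
  have key : ∀ j : Fin N, ∫ o, (inner ℝ a (o : EuclideanSpace ℝ (Fin N))) ^ 2 ∂(uniformSphere N)
      = ‖a‖ ^ 2 * ∫ o, ((o : EuclideanSpace ℝ (Fin N)) j) ^ 2 ∂(uniformSphere N) := by
    intro j
    set b : EuclideanSpace ℝ (Fin N) := ‖a‖ • EuclideanSpace.single j 1 with hb
    have hab : ‖a‖ = ‖b‖ := by simp [hb, norm_smul]
    -- Since `a` and `b` have equal norms, the reflection in the hyperplane orthogonal to `a - b`
    -- sends `a` to `b`.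
    have hU := Submodule.reflection_sub hab
    set U := (Submodule.span ℝ {a - b})ᗮ.reflection
    have h1 := integral_uniformSphere_comp_linearIsometryEquiv U
      (f := fun v ↦ (inner ℝ b v) ^ 2) (by fun_prop)
    rw [← integral_const_mul]
    calc _ = ∫ o, (inner ℝ b (U (o : EuclideanSpace ℝ (Fin N)))) ^ 2 ∂(uniformSphere N) := by
          simp_rw [← hU, LinearIsometryEquiv.inner_map_map]
      _ = _ := h1
      _ = _ := by
          congr 1 with o
          simp [hb, inner_smul_left, EuclideanSpace.inner_single_left, mul_pow]
  have hsum : ∑ j : Fin N, ∫ o, ((o : EuclideanSpace ℝ (Fin N)) j) ^ 2 ∂(uniformSphere N) = 1 := by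
    rw [← integral_finsetSum _ fun j _ ↦ integrable_uniformSphere hN (by fun_prop)]
    simp_rw [← EuclideanSpace.real_norm_sq_eq]
    simp
  have hN' : (N : ℝ) ≠ 0 := by positivity
  rw [eq_div_iff hN', mul_comm]
  calc _ = ∑ _j : Fin N, ∫ o, (inner ℝ a (o : EuclideanSpace ℝ (Fin N))) ^ 2 ∂(uniformSphere N) := by
        simp
    _ = _ := by rw [Finset.sum_congr rfl fun j _ ↦ key j, ← Finset.mul_sum, hsum, mul_one]

/-- The `i`-th row of the Jacobian, as a vector. -/
noncomputable def jacobianRow {N M : ℕ}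
    (h : EuclideanSpace ℝ (Fin N) → EuclideanSpace ℝ (Fin M))
    (x : EuclideanSpace ℝ (Fin N)) (i : Fin M) : EuclideanSpace ℝ (Fin N) :=
  WithLp.toLp 2 (jacobian h x i)

/-! ### The derivative in terms of the Jacobian rows, and the limit of the ratio -/

section Deterministic

variable {N M : ℕ} (h : EuclideanSpace ℝ (Fin N) → EuclideanSpace ℝ (Fin M))
  (x : EuclideanSpace ℝ (Fin N))

theorem fderiv_apply_eq_inner_jacobianRow (v : EuclideanSpace ℝ (Fin N)) (i : Fin M) :
    fderiv ℝ h x v i = inner ℝ (jacobianRow h x i) v := by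
  have hv : v = ∑ j, v j • EuclideanSpace.single j (1 : ℝ) := by
    ext k; simp [Finset.sum_apply, Pi.single_apply]
  conv_lhs => rw [hv]
  simp [PiLp.inner_apply, jacobianRow, jacobian]

theorem norm_fderiv_apply_sq (v : EuclideanSpace ℝ (Fin N)) :
    ‖fderiv ℝ h x v‖ ^ 2 = ∑ i, (inner ℝ (jacobianRow h x i) v) ^ 2 := by
  simp_rw [EuclideanSpace.real_norm_sq_eq, fderiv_apply_eq_inner_jacobianRow]

theorem sum_inner_jacobianRow_sq_le (v : EuclideanSpace ℝ (Fin N)) :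
    ∑ i, (inner ℝ (jacobianRow h x i) v) ^ 2 ≤ ‖fderiv ℝ h x‖ ^ 2 * ‖v‖ ^ 2 := by
  rw [← norm_fderiv_apply_sq, ← mul_pow]
  gcongr
  exact ContinuousLinearMap.le_opNorm _ _

/-- Testing the derivative on the row itself, the `i`-th term alone contributes the fourth power of
the row's norm. -/
theorem norm_jacobianRow_le (i : Fin M) : ‖jacobianRow h x i‖ ≤ ‖fderiv ℝ h x‖ := by
  by_contra! hlt
  have h0 : 0 < ‖jacobianRow h x i‖ := (norm_nonneg _).trans_lt hlt
  have h1 := sum_inner_jacobianRow_sq_le h x (jacobianRow h x i)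
  have h2 := Finset.single_le_sum
    (f := fun k ↦ (inner ℝ (jacobianRow h x k) (jacobianRow h x i)) ^ 2)
    (fun k _ ↦ sq_nonneg _) (Finset.mem_univ i)
  rw [real_inner_self_eq_norm_sq] at h2
  have h3 : ‖jacobianRow h x i‖ ^ 2 ≤ ‖fderiv ℝ h x‖ ^ 2 := by
    refine le_of_mul_le_mul_right ?_ (by positivity : 0 < ‖jacobianRow h x i‖ ^ 2)
    linarith [sq (‖jacobianRow h x i‖ ^ 2)]
  exact absurd ((sq_le_sq₀ h0.le (norm_nonneg _)).1 h3) (not_le.2 hlt)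

theorem integral_norm_fderiv_sq (hN : 1 ≤ N) :
    ∫ o, ‖fderiv ℝ h x (o : EuclideanSpace ℝ (Fin N))‖ ^ 2 ∂(uniformSphere N)
      = (∑ i, ‖jacobianRow h x i‖ ^ 2) / N := by
  simp_rw [norm_fderiv_apply_sq]
  rw [integral_finsetSum _ fun i _ ↦ integrable_uniformSphere hN (by fun_prop)]
  simp_rw [integral_inner_sq_uniformSphere hN, Finset.sum_div]

/-- The mean of `‖∇h(x) o‖` over the unit sphere. -/
noncomputable def meanDerivative : ℝ :=
  ∫ o, ‖fderiv ℝ h x (o : EuclideanSpace ℝ (Fin N))‖ ∂(uniformSphere N)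

/-- The variance of `‖∇h(x) o‖` is nonnegative. -/
theorem meanDerivative_sq_le (hN : 1 ≤ N) :
    meanDerivative h x ^ 2 ≤ (∑ i, ‖jacobianRow h x i‖ ^ 2) / N := by
  have := isProbabilityMeasure_uniformSphere hN
  rw [← integral_norm_fderiv_sq h x hN]
  have hL : MemLp (fun o : Metric.sphere (0 : EuclideanSpace ℝ (Fin N)) 1 ↦
      ‖fderiv ℝ h x (o : EuclideanSpace ℝ (Fin N))‖) 2 (uniformSphere N) :=
    (memLp_two_iff_integrable_sq (Continuous.aestronglyMeasurable (by fun_prop))).2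
      (integrable_uniformSphere hN (by fun_prop))
  have hv := variance_nonneg (fun o : Metric.sphere (0 : EuclideanSpace ℝ (Fin N)) 1 ↦
      ‖fderiv ℝ h x (o : EuclideanSpace ℝ (Fin N))‖) (uniformSphere N)
  rw [variance_eq_sub hL] at hv
  simpa [meanDerivative] using hv

theorem meanDerivative_pos (hN : 1 ≤ N) (hJ : 0 < ∑ i, ‖jacobianRow h x i‖ ^ 2) :
    0 < meanDerivative h x := by
  have := isProbabilityMeasure_uniformSphere hN
  refine lt_of_le_of_ne (integral_nonneg fun o ↦ norm_nonneg _) fun h0 ↦ ?_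
  have h1 := (integral_eq_zero_iff_of_nonneg (fun o ↦ norm_nonneg _)
    (integrable_uniformSphere hN (by fun_prop))).1 h0.symm
  have h2 : ∫ o, ‖fderiv ℝ h x (o : EuclideanSpace ℝ (Fin N))‖ ^ 2 ∂(uniformSphere N) = 0 := by
    rw [integral_eq_zero_of_ae]
    filter_upwards [h1] with o ho
    simpa using ho
  rw [integral_norm_fderiv_sq h x hN] at h2
  have : 0 < (∑ i, ‖jacobianRow h x i‖ ^ 2) / (N : ℝ) := by positivity
  exact this.ne' h2

variable {h x}

/-- The linearisation error is uniform over the ball, so it passes both to the supremum and to the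
spherical mean. -/
theorem eventually_norm_sub_fderiv_le (hd : DifferentiableAt ℝ h x) {c : ℝ} (hc : 0 < c) :
    ∀ᶠ ε in 𝓝[>] (0 : ℝ), ∀ w : EuclideanSpace ℝ (Fin N), ‖w‖ ≤ ε →
      ‖h (x + w) - h x - fderiv ℝ h x w‖ ≤ c * ε := by
  have h1 := (hasFDerivAt_iff_isLittleO_nhds_zero.1 hd.hasFDerivAt).def hc
  obtain ⟨r, hr, hb⟩ := Metric.eventually_nhds_iff.1 h1
  filter_upwards [Ioo_mem_nhdsGT hr] with ε hε w hw
  exact (hb (by simpa using hw.trans_lt hε.2)).trans (by gcongr)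

theorem bddAbove_changes {c ε : ℝ}
    (hb : ∀ w : EuclideanSpace ℝ (Fin N), ‖w‖ ≤ ε →
      ‖h (x + w) - h x - fderiv ℝ h x w‖ ≤ c * ε) :
    (‖fderiv ℝ h x‖ + c) * ε ∈ upperBounds (changes h x ε) := by
  rintro _ ⟨w, hw, rfl⟩
  have h1 := norm_le_norm_sub_add (h (x + w) - h x) (fderiv ℝ h x w)
  have h2 : ‖fderiv ℝ h x w‖ ≤ ‖fderiv ℝ h x‖ * ε :=
    (ContinuousLinearMap.le_opNorm _ _).trans (by gcongr)
  linarith [hb w hw]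

theorem abs_worstChange_sub_le {c ε : ℝ} (hε : 0 < ε) (hc : 0 ≤ c)
    (hb : ∀ w : EuclideanSpace ℝ (Fin N), ‖w‖ ≤ ε →
      ‖h (x + w) - h x - fderiv ℝ h x w‖ ≤ c * ε) :
    |worstChange h x ε / ε - ‖fderiv ℝ h x‖| ≤ c := by
  have hu := bddAbove_changes hb
  have hne : (changes h x ε).Nonempty := ⟨_, 0, by simpa using hε.le, rfl⟩
  -- Needed below: a bound for the operator norm must itself be nonnegative.
  have hS : 0 ≤ worstChange h x ε :=
    le_csSup_of_le ⟨_, hu⟩ hne.some_mem (by obtain ⟨w, -, hw⟩ := hne.some_mem; rw [hw]; positivity)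
  rw [abs_le]
  constructor
  · have : ‖fderiv ℝ h x‖ ≤ (worstChange h x ε + c * ε) / ε := by
      refine ContinuousLinearMap.opNorm_le_of_unit_norm (by positivity) fun z hz ↦ ?_
      have hw : ‖ε • z‖ ≤ ε := by rw [norm_smul, hz, Real.norm_of_nonneg hε.le, mul_one]
      have h1 : ‖h (x + ε • z) - h x‖ ≤ worstChange h x ε := le_csSup ⟨_, hu⟩ ⟨_, hw, rfl⟩
      have h2 := norm_le_norm_sub_add (fderiv ℝ h x (ε • z)) (h (x + ε • z) - h x)
      rw [norm_sub_rev] at h2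
      have h3 := hb _ hw
      rw [le_div_iff₀ hε]
      have h4 : ‖fderiv ℝ h x (ε • z)‖ = ‖fderiv ℝ h x z‖ * ε := by
        rw [map_smul, norm_smul, Real.norm_of_nonneg hε.le, mul_comm]
      linarith
    rw [add_div, mul_div_cancel_right₀ _ hε.ne'] at this
    linarith
  · have : worstChange h x ε / ε ≤ ‖fderiv ℝ h x‖ + c := by
      rw [div_le_iff₀ hε]; exact csSup_le hne hu
    linarith

theorem abs_directionalChange_sub_le {c ε : ℝ} (hε : 0 < ε)
    (hb : ∀ w : EuclideanSpace ℝ (Fin N), ‖w‖ ≤ ε →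
      ‖h (x + w) - h x - fderiv ℝ h x w‖ ≤ c * ε)
    (o : Metric.sphere (0 : EuclideanSpace ℝ (Fin N)) 1) :
    |directionalChange h x o ε - ε * ‖fderiv ℝ h x (o : EuclideanSpace ℝ (Fin N))‖| ≤ c * ε := by
  have hw : ‖ε • (o : EuclideanSpace ℝ (Fin N))‖ ≤ ε := by
    rw [norm_smul, norm_eq_of_mem_sphere, Real.norm_of_nonneg hε.le, mul_one]
  have h1 : ε * ‖fderiv ℝ h x (o : EuclideanSpace ℝ (Fin N))‖
      = ‖fderiv ℝ h x (ε • (o : EuclideanSpace ℝ (Fin N)))‖ := by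
    rw [map_smul, norm_smul, Real.norm_of_nonneg hε.le]
  rw [h1]
  exact (abs_norm_sub_norm_le _ _).trans (hb _ hw)

theorem integrable_directionalChange (hN : 1 ≤ N) {c ε : ℝ} (hε : 0 < ε)
    (hb : ∀ w : EuclideanSpace ℝ (Fin N), ‖w‖ ≤ ε →
      ‖h (x + w) - h x - fderiv ℝ h x w‖ ≤ c * ε)
    (hm : AEMeasurable (fun o ↦ directionalChange h x o ε) (uniformSphere N)) :
    Integrable (fun o ↦ directionalChange h x o ε) (uniformSphere N) := by
  have := isProbabilityMeasure_uniformSphere hN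
  refine Integrable.of_bound hm.aestronglyMeasurable ((‖fderiv ℝ h x‖ + c) * ε) (ae_of_all _ ?_)
  intro o
  rw [Real.norm_of_nonneg (show 0 ≤ directionalChange h x o ε from norm_nonneg _)]
  refine bddAbove_changes hb ⟨_, ?_, rfl⟩
  rw [norm_smul, norm_eq_of_mem_sphere, Real.norm_of_nonneg hε.le, mul_one]

theorem abs_expectedChange_sub_le (hN : 1 ≤ N) {c ε : ℝ} (hε : 0 < ε)
    (hb : ∀ w : EuclideanSpace ℝ (Fin N), ‖w‖ ≤ ε →
      ‖h (x + w) - h x - fderiv ℝ h x w‖ ≤ c * ε)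
    (hm : AEMeasurable (fun o ↦ directionalChange h x o ε) (uniformSphere N)) :
    |expectedChange h x ε / ε - meanDerivative h x| ≤ c := by
  have := isProbabilityMeasure_uniformSphere hN
  have hi := integrable_directionalChange hN hε hb hm
  have hi' : Integrable (fun o : Metric.sphere (0 : EuclideanSpace ℝ (Fin N)) 1 ↦
      ε * ‖fderiv ℝ h x (o : EuclideanSpace ℝ (Fin N))‖) (uniformSphere N) :=
    integrable_uniformSphere hN (by fun_prop)
  have h1 : expectedChange h x ε - ε * meanDerivative h x
      = ∫ o, (directionalChange h x o ε - ε * ‖fderiv ℝ h x (o : EuclideanSpace ℝ (Fin N))‖)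
        ∂(uniformSphere N) := by
    rw [integral_sub hi hi', integral_const_mul, expectedChange, meanDerivative]
  have h2 : |expectedChange h x ε - ε * meanDerivative h x| ≤ c * ε := by
    rw [h1, ← Real.norm_eq_abs]
    refine (norm_integral_le_of_norm_le_const (ae_of_all _
      (abs_directionalChange_sub_le hε hb))).trans ?_
    simp
  have h3 : expectedChange h x ε / ε - meanDerivative h x
      = (expectedChange h x ε - ε * meanDerivative h x) / ε := by field_simp
  rwa [h3, abs_div, abs_of_pos hε, div_le_iff₀ hε]

theorem tendsto_worstChange_div (hd : DifferentiableAt ℝ h x) :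
    Tendsto (fun ε ↦ worstChange h x ε / ε) (𝓝[>] (0 : ℝ)) (𝓝 ‖fderiv ℝ h x‖) := by
  rw [Metric.tendsto_nhds]
  intro c hc
  filter_upwards [eventually_norm_sub_fderiv_le hd (half_pos hc), self_mem_nhdsWithin]
    with ε hb hε
  rw [Real.dist_eq]
  linarith [abs_worstChange_sub_le hε (half_pos hc).le hb]

theorem tendsto_expectedChange_div (hN : 1 ≤ N) (hd : DifferentiableAt ℝ h x)
    (hm : MeasurableChange h x) :
    Tendsto (fun ε ↦ expectedChange h x ε / ε) (𝓝[>] (0 : ℝ)) (𝓝 (meanDerivative h x)) := by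
  rw [Metric.tendsto_nhds]
  intro c hc
  filter_upwards [eventually_norm_sub_fderiv_le hd (half_pos hc), self_mem_nhdsWithin, hm]
    with ε hb hε hmε
  rw [Real.dist_eq]
  linarith [abs_expectedChange_sub_le hN hε hb hmε]

theorem limitRatioAtLeast_of_le (hN : 1 ≤ N) (hd : DifferentiableAt ℝ h x)
    (hm : MeasurableChange h x) (hJ : 0 < ∑ i, ‖jacobianRow h x i‖ ^ 2) {c : ℝ}
    (hc : c * √(∑ i, ‖jacobianRow h x i‖ ^ 2) ≤ √N * ‖fderiv ℝ h x‖) :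
    LimitRatioAtLeast h x c := by
  have hpos := meanDerivative_pos h x hN hJ
  have ht := tendsto_expectedChange_div hN hd hm
  refine ⟨?_, ‖fderiv ℝ h x‖ / meanDerivative h x, ?_, ?_⟩
  · filter_upwards [eventually_norm_sub_fderiv_le hd one_pos, self_mem_nhdsWithin, hm,
      ht.eventually_const_lt hpos] with ε hb hε hmε hp
    exact ⟨⟨_, bddAbove_changes hb⟩, integrable_directionalChange hN hε hb hmε,
      (div_pos_iff_of_pos_right hε).1 hp⟩
  · refine ((tendsto_worstChange_div hd).div ht hpos.ne').congr' ?_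
    filter_upwards [self_mem_nhdsWithin] with ε hε
    exact div_div_div_cancel_right₀ (ne_of_gt hε) _ _
  · rw [le_div_iff₀ hpos]
    -- Multiplying the upper bound on the mean by `c` requires `0 ≤ c`; otherwise the claim is
    -- trivial.
    rcases le_total c 0 with hc0 | hc0
    · exact (mul_nonpos_of_nonpos_of_nonneg hc0 hpos.le).trans (norm_nonneg _)
    have hsN : 0 < √(N : ℝ) := Real.sqrt_pos.2 (by positivity)
    have h1 : meanDerivative h x ≤ √(∑ i, ‖jacobianRow h x i‖ ^ 2) / √N := by
      rw [← Real.sqrt_div' _ (by positivity)]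
      exact Real.le_sqrt_of_sq_le (meanDerivative_sq_le h x hN)
    calc c * meanDerivative h x ≤ c * (√(∑ i, ‖jacobianRow h x i‖ ^ 2) / √N) := by gcongr
      _ ≤ ‖fderiv ℝ h x‖ := by
        rw [← mul_div_assoc, div_le_iff₀ hsN]
        linarith

theorem sum_norm_jacobianRow_sq_pos (hJ : jacobian h x ≠ 0) :
    0 < ∑ i, ‖jacobianRow h x i‖ ^ 2 := by
  refine lt_of_le_of_ne (by positivity) fun h0 ↦ hJ ?_
  rw [eq_comm, Finset.sum_eq_zero_iff_of_nonneg (fun i _ ↦ by positivity)] at h0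
  ext i j
  have h1 : jacobianRow h x i = 0 := by simpa using h0 i (Finset.mem_univ i)
  exact congrArg (fun v : EuclideanSpace ℝ (Fin N) ↦ v j) h1

theorem limitRatioAtLeast_sqrt_div (hd : DifferentiableAt ℝ h x)
    (hm : MeasurableChange h x) (hJ : jacobian h x ≠ 0) :
    LimitRatioAtLeast h x √((N : ℝ) / (M : ℝ)) := by
  have hN : 1 ≤ N := by
    by_contra! hN0
    obtain rfl : N = 0 := by omega
    exact hJ (Matrix.ext fun i j ↦ j.elim0)
  have hM : 0 < M := by
    by_contra! hM0
    obtain rfl : M = 0 := by omega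
    exact hJ (Matrix.ext fun i j ↦ i.elim0)
  refine limitRatioAtLeast_of_le hN hd hm (sum_norm_jacobianRow_sq_pos hJ) ?_
  have h1 : √(∑ i, ‖jacobianRow h x i‖ ^ 2) ≤ √M * ‖fderiv ℝ h x‖ := by
    rw [← Real.sqrt_sq (norm_nonneg (fderiv ℝ h x)), ← Real.sqrt_mul (by positivity)]
    apply Real.sqrt_le_sqrt
    calc ∑ i, ‖jacobianRow h x i‖ ^ 2 ≤ ∑ _i : Fin M, ‖fderiv ℝ h x‖ ^ 2 := by
          gcongr with i; exact norm_jacobianRow_le h x i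
      _ = _ := by simp
  have hsM : 0 < √(M : ℝ) := Real.sqrt_pos.2 (by positivity)
  rw [Real.sqrt_div' _ (by positivity), div_mul_eq_mul_div, div_le_iff₀ hsM]
  calc _ ≤ √N * (√M * ‖fderiv ℝ h x‖) := by gcongr
    _ = _ := by ring

end Deterministic

/-! ### Concentration of sums of squared Gaussians -/

theorem memLp_sq_gaussianReal : MemLp (fun y : ℝ ↦ y ^ 2) 2 (gaussianReal 0 1) := by
  have h4 : MemLp id (4 : ℕ) (gaussianReal 0 1) :=
    memLp_id_gaussianReal' _ (ENNReal.natCast_ne_top _)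
  rw [memLp_two_iff_integrable_sq (by fun_prop)]
  refine (h4.integrable_norm_pow (by norm_num)).congr (ae_of_all _ fun y ↦ ?_)
  simp only [id, Real.norm_eq_abs]
  rw [← pow_mul, (by decide : Even 4).pow_abs]

theorem integral_sq_gaussianReal : ∫ y, y ^ 2 ∂(gaussianReal 0 1) = 1 := by
  have h := variance_eq_sub (memLp_id_gaussianReal' (μ := 0) (v := 1) 2 (by norm_num))
  rw [variance_id_gaussianReal] at h
  simpa using h.symm

/-- The variance of the square of a standard Gaussian. -/
noncomputable def sqGaussianVariance : ℝ := Var[fun y ↦ y ^ 2; gaussianReal 0 1]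

theorem sqGaussianVariance_nonneg : 0 ≤ sqGaussianVariance := variance_nonneg _ _

/-- Chebyshev's inequality: the squares have mean one, and by independence their variances add. -/
theorem measure_abs_sum_sq_sub_card_ge_le {Ω ι : Type*} [MeasurableSpace Ω] {P : Measure Ω}
    [IsProbabilityMeasure P] [Fintype ι] {Y : ι → Ω → ℝ}
    (hlaw : ∀ i, HasLaw (Y i) (gaussianReal 0 1) P) (hind : iIndepFun Y P) {c : ℝ} (hc : 0 < c) :
    P {ω | c ≤ |∑ i, Y i ω ^ 2 - Fintype.card ι|} ≤
      ENNReal.ofReal (Fintype.card ι * sqGaussianVariance / c ^ 2) := by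
  have hL : ∀ i, MemLp (fun ω ↦ Y i ω ^ 2) 2 P := fun i ↦ by
    have h := memLp_sq_gaussianReal
    rw [← (hlaw i).map_eq] at h
    exact h.comp_of_map (hlaw i).aemeasurable
  have hE : ∀ i, ∫ ω, Y i ω ^ 2 ∂P = 1 := fun i ↦ by
    rw [← integral_sq_gaussianReal, ← (hlaw i).map_eq,
      integral_map (hlaw i).aemeasurable (by fun_prop)]
  have hV : ∀ i, Var[fun ω ↦ Y i ω ^ 2; P] = sqGaussianVariance := fun i ↦ by
    rw [sqGaussianVariance, ← (hlaw i).map_eq,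
      variance_map (by fun_prop) (hlaw i).aemeasurable]
    rfl
  have hsum : Var[∑ i, fun ω ↦ Y i ω ^ 2; P] = Fintype.card ι * sqGaussianVariance := by
    rw [IndepFun.variance_sum (fun i _ ↦ hL i)]
    · simp [hV]
    · intro i _ j _ hij
      exact (hind.indepFun hij).comp (φ := fun y ↦ y ^ 2) (ψ := fun y ↦ y ^ 2)
        (by fun_prop) (by fun_prop)
  have hmean : ∫ ω, (∑ i, fun ω ↦ Y i ω ^ 2) ω ∂P = (Fintype.card ι : ℝ) := by
    simp only [Finset.sum_apply]
    rw [integral_finsetSum _ fun i _ ↦ (hL i).integrable (by norm_num)]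
    simp [hE]
  have := meas_ge_le_variance_div_sq (memLp_finsetSum' Finset.univ fun i _ ↦ hL i) hc
  rw [hsum, hmean] at this
  simpa using this

/-! ### Inner products of independent Gaussian rows -/

section GaussianRows

variable {N : ℕ}

theorem hasLaw_inner_stdGaussian {v : EuclideanSpace ℝ (Fin N)} (hv : ‖v‖ = 1) :
    HasLaw (fun a ↦ inner ℝ a v) (gaussianReal 0 1) (stdGaussian (EuclideanSpace ℝ (Fin N))) := by
  refine ⟨by fun_prop, ?_⟩
  have h := IsGaussian.map_eq_gaussianReal (μ := stdGaussian (EuclideanSpace ℝ (Fin N)))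
    (innerSL ℝ v)
  rw [integral_strongDual_stdGaussian, variance_dual_stdGaussian, innerSL_apply_norm, hv] at h
  simp only [one_pow, Real.toNNReal_one] at h
  rw [← h]
  congr 1 with a
  exact real_inner_comm _ _

/-- The law of `k` independent standard Gaussian vectors in `ℝ^N`. -/
noncomputable def gaussianRows (N k : ℕ) : Measure (Fin k → EuclideanSpace ℝ (Fin N)) :=
  Measure.pi fun _ ↦ stdGaussian (EuclideanSpace ℝ (Fin N))

instance (N k : ℕ) : IsProbabilityMeasure (gaussianRows N k) := by
  unfold gaussianRows; infer_instance

/-- After normalising `v`, the inner products are independent standard Gaussians. The bound does not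
depend on `v`, so `v` can later be randomised; the strict inequality makes the event empty at `v =
0`. -/
theorem gaussianRows_inner_sq_le {k : ℕ} {v : EuclideanSpace ℝ (Fin N)} {c : ℝ} (hc : 0 < c) :
    gaussianRows N k {a | ∑ i, (inner ℝ (a i) v) ^ 2 < (k - c) * ‖v‖ ^ 2} ≤
      ENNReal.ofReal (k * sqGaussianVariance / c ^ 2) := by
  rcases eq_or_ne v 0 with rfl | hv
  · simp
  set u := ‖v‖⁻¹ • v
  have hv' : 0 < ‖v‖ := norm_pos_iff.2 hv
  have hu : ‖u‖ = 1 := norm_smul_inv_norm hv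
  have hvu : v = ‖v‖ • u := by simp [u, smul_smul, hv'.ne']
  have hlaw : ∀ i : Fin k, HasLaw (fun a : Fin k → EuclideanSpace ℝ (Fin N) ↦ inner ℝ (a i) u)
      (gaussianReal 0 1) (gaussianRows N k) := fun i ↦
    (hasLaw_inner_stdGaussian hu).fun_comp (measurePreserving_eval
      (fun _ : Fin k ↦ stdGaussian (EuclideanSpace ℝ (Fin N))) i).hasLaw
  have hind : iIndepFun (fun (i : Fin k) (a : Fin k → EuclideanSpace ℝ (Fin N)) ↦
      inner ℝ (a i) u) (gaussianRows N k) :=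
    iIndepFun_pi (X := fun _ (a : EuclideanSpace ℝ (Fin N)) ↦ inner ℝ a u) (fun i ↦ by fun_prop)
  have h := measure_abs_sum_sq_sub_card_ge_le hlaw hind hc
  rw [Fintype.card_fin] at h
  refine (measure_mono fun a ha ↦ ?_).trans h
  have h1 : ∑ i, (inner ℝ (a i) v) ^ 2 = (∑ i, (inner ℝ (a i) u) ^ 2) * ‖v‖ ^ 2 := by
    rw [Finset.sum_mul]
    refine Finset.sum_congr rfl fun i _ ↦ ?_
    conv_lhs => rw [hvu]
    rw [inner_smul_right]; ring
  simp only [Set.mem_ofPred_eq] at ha ⊢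
  rw [h1] at ha
  have h2 := lt_of_mul_lt_mul_right ha (by positivity)
  rw [abs_sub_comm]
  exact (by linarith : c ≤ k - ∑ i, (inner ℝ (a i) u) ^ 2).trans (le_abs_self _)

/-- Row 0 is independent of the others, so by Fubini it can be frozen and the fixed-vector bound
integrated. -/
theorem gaussianRows_inner_row_zero_sq_le {k : ℕ} {c : ℝ} (hc : 0 < c) :
    gaussianRows N (k + 1) {a | ∑ i : Fin k, (inner ℝ (a i.succ) (a 0)) ^ 2
        < (k - c) * ‖a 0‖ ^ 2} ≤
      ENNReal.ofReal (k * sqGaussianVariance / c ^ 2) := by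
  have hmp := measurePreserving_piFinSuccAbove
    (fun _ : Fin (k + 1) ↦ stdGaussian (EuclideanSpace ℝ (Fin N))) 0
  set S : Set (EuclideanSpace ℝ (Fin N) × (Fin k → EuclideanSpace ℝ (Fin N))) :=
    {p | ∑ i, (inner ℝ (p.2 i) p.1) ^ 2 < (k - c) * ‖p.1‖ ^ 2} with hS
  have hSm : MeasurableSet S := measurableSet_lt (by fun_prop) (by fun_prop)
  have h1 := hmp.measure_preimage hSm.nullMeasurableSet
  change gaussianRows N (k + 1) _ = _ at h1
  calc _ = ((stdGaussian (EuclideanSpace ℝ (Fin N))).prod (gaussianRows N k)) S := by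
        refine Eq.trans ?_ h1
        congr 1
    _ = ∫⁻ v, gaussianRows N k (Prod.mk v ⁻¹' S) ∂(stdGaussian (EuclideanSpace ℝ (Fin N))) :=
        Measure.prod_apply hSm
    _ ≤ ∫⁻ _v, ENNReal.ofReal (k * sqGaussianVariance / c ^ 2)
          ∂(stdGaussian (EuclideanSpace ℝ (Fin N))) :=
        lintegral_mono fun v ↦ gaussianRows_inner_sq_le hc
    _ = _ := by simp

theorem hasLaw_gaussianRows {M : ℕ} {Ω : Type*} [MeasurableSpace Ω] {P : Measure Ω}
    [IsProbabilityMeasure P] {X : Fin M × Fin N → Ω → ℝ}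
    (hlaw : ∀ p, HasLaw (X p) (gaussianReal 0 1) P) (hind : iIndepFun X P) :
    HasLaw (fun ω i ↦ (WithLp.toLp 2 fun j ↦ X (i, j) ω : EuclideanSpace ℝ (Fin N)))
      (gaussianRows N M) P := by
  have h1 : HasLaw (fun ω p ↦ X p ω) (Measure.pi fun _ ↦ gaussianReal 0 1) P := by
    rw [← Measure.infinitePi_eq_pi]
    exact hind.hasLaw_infinitePi hlaw (aemeasurable_pi_lambda _ fun p ↦ (hlaw p).aemeasurable)
  have h2 : HasLaw (MeasurableEquiv.curry (Fin M) (Fin N) ℝ)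
      (Measure.pi fun _ ↦ Measure.pi fun _ ↦ gaussianReal 0 1)
      (Measure.pi fun _ ↦ gaussianReal 0 1) := by
    refine ⟨by fun_prop, ?_⟩
    simp_rw [← Measure.infinitePi_eq_pi]
    exact Measure.infinitePi_map_curry fun _ _ ↦ gaussianReal 0 1
  have h3 : HasLaw (fun (a : Fin M → Fin N → ℝ) i ↦
      (WithLp.toLp 2 (a i) : EuclideanSpace ℝ (Fin N))) (gaussianRows N M)
      (Measure.pi fun _ ↦ Measure.pi fun _ ↦ gaussianReal 0 1) := by
    refine ⟨(measurable_pi_lambda _ fun i ↦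
      (PiLp.continuous_toLp 2 _).measurable.comp (measurable_pi_apply i)).aemeasurable, ?_⟩
    rw [gaussianRows, ← map_pi_eq_stdGaussian]
    exact Measure.pi_map_pi (f := fun _ : Fin M ↦ (WithLp.toLp 2 :
      (Fin N → ℝ) → EuclideanSpace ℝ (Fin N))) (fun _ ↦ (PiLp.continuous_toLp 2 _).measurable.aemeasurable)
  exact h3.fun_comp (h2.fun_comp h1)

end GaussianRows

/-! ### The random case -/

theorem limitRatioAtLeast_of_row_bounds {N m : ℕ}
    {h : EuclideanSpace ℝ (Fin N) → EuclideanSpace ℝ (Fin (m + 1))}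
    {x : EuclideanSpace ℝ (Fin N)} (hd : DifferentiableAt ℝ h x) (hm : MeasurableChange h x)
    {t : ℝ} (ht0 : 0 < t) (ht1 : t ≤ 1 / 4) (htN : 1 ≤ t * N)
    (hS : ∑ i, ‖jacobianRow h x i‖ ^ 2 ≤ (1 + t) * (N * ((m : ℝ) + 1)))
    (hr : (1 - t) * N ≤ ‖jacobianRow h x 0‖ ^ 2)
    (hrest : (m - t * (N + ((m : ℝ) + 1))) * ‖jacobianRow h x 0‖ ^ 2 ≤
      ∑ i : Fin m, (inner ℝ (jacobianRow h x i.succ) (jacobianRow h x 0)) ^ 2) :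
    LimitRatioAtLeast h x ((1 - 4 * t) * √((N + ((m : ℝ) + 1)) / ((m : ℝ) + 1))) := by
  have hNpos : (0 : ℝ) < N := by
    by_contra! hN0
    nlinarith
  have hN : 1 ≤ N := by exact_mod_cast hNpos
  have hm0 : (0 : ℝ) < (m : ℝ) + 1 := by positivity
  have hr0 : 0 < ‖jacobianRow h x 0‖ ^ 2 :=
    (mul_pos (by linarith) hNpos).trans_le hr
  -- Test on row 0. The loss of `3t` on `N` combines `t` from the norm of row 0, `t` from the other
  -- rows, and `1 ≤ t * N`, which absorbs having only `m` other rows instead of `m + 1`.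
  have hF : (1 - 3 * t) * (N + ((m : ℝ) + 1)) ≤ ‖fderiv ℝ h x‖ ^ 2 := by
    have h1 := sum_inner_jacobianRow_sq_le h x (jacobianRow h x 0)
    rw [Fin.sum_univ_succ, real_inner_self_eq_norm_sq] at h1
    have h2 : ‖jacobianRow h x 0‖ ^ 2 + (m - t * (N + ((m : ℝ) + 1))) ≤ ‖fderiv ℝ h x‖ ^ 2 := by
      refine le_of_mul_le_mul_right ?_ hr0
      linarith [sq (‖jacobianRow h x 0‖ ^ 2)]
    linarith [mul_pos ht0 hm0]
  have hpos : 0 < ∑ i, ‖jacobianRow h x i‖ ^ 2 :=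
    hr0.trans_le (Finset.single_le_sum (f := fun i ↦ ‖jacobianRow h x i‖ ^ 2)
      (fun i _ ↦ by positivity) (Finset.mem_univ 0))
  refine limitRatioAtLeast_of_le hN hd hm hpos (abs_le_of_sq_le_sq' ?_ (by positivity)).2
  have hq : 0 ≤ ((N : ℝ) + ((m : ℝ) + 1)) / ((m : ℝ) + 1) := by positivity
  rw [mul_pow, mul_pow, mul_pow, Real.sq_sqrt hq, Real.sq_sqrt hpos.le, Real.sq_sqrt hNpos.le]
  -- The difference of the two sides is `4t(1 - 2t - 4t²)`, nonnegative for `0 ≤ t ≤ 1/4`.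
  have h3 : (1 - 4 * t) ^ 2 * (1 + t) ≤ 1 - 3 * t := by
    have h4 : 0 ≤ t * (1 - 4 * t) := mul_nonneg ht0.le (by linarith)
    nlinarith [mul_nonneg ht0.le h4]
  calc (1 - 4 * t) ^ 2 * ((N + ((m : ℝ) + 1)) / ((m : ℝ) + 1)) * ∑ i, ‖jacobianRow h x i‖ ^ 2
      ≤ (1 - 4 * t) ^ 2 * ((N + ((m : ℝ) + 1)) / ((m : ℝ) + 1)) *
        ((1 + t) * (N * ((m : ℝ) + 1))) := by gcongr
    _ = ((1 - 4 * t) ^ 2 * (1 + t)) * (N * (N + ((m : ℝ) + 1))) := by field_simp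
    _ ≤ (1 - 3 * t) * (N * (N + ((m : ℝ) + 1))) := by gcongr
    _ = N * ((1 - 3 * t) * (N + ((m : ℝ) + 1))) := by ring
    _ ≤ _ := by gcongr

theorem LimitRatioAtLeast.mono {N M : ℕ}
    {h : EuclideanSpace ℝ (Fin N) → EuclideanSpace ℝ (Fin M)}
    {x : EuclideanSpace ℝ (Fin N)} {c d : ℝ} (hcd : c ≤ d) (hd : LimitRatioAtLeast h x d) :
    LimitRatioAtLeast h x c := by
  obtain ⟨h1, L, hL, hdL⟩ := hd
  exact ⟨h1, L, hL, hcd.trans hdL⟩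

/-- Up to a null set, failure forces one of three deviations: of the Frobenius norm, of row 0, or of
the inner products with row 0. Each has probability at most `q`, free of `m`. -/
theorem measure_not_limitRatioAtLeast_le {N m : ℕ} {Ω : Type*} [MeasurableSpace Ω]
    {P : Measure Ω} [IsProbabilityMeasure P]
    {h : Ω → EuclideanSpace ℝ (Fin N) → EuclideanSpace ℝ (Fin (m + 1))}
    {x : EuclideanSpace ℝ (Fin N)}
    (hdm : ∀ᵐ ω ∂P, DifferentiableAt ℝ (h ω) x ∧ MeasurableChange (h ω) x)
    (hlaw : ∀ i j, HasLaw (fun ω ↦ jacobian (h ω) x i j) (gaussianReal 0 1) P)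
    (hind : iIndepFun (fun (p : Fin (m + 1) × Fin N) (ω : Ω) ↦ jacobian (h ω) x p.1 p.2) P)
    {t : ℝ} (ht0 : 0 < t) (ht1 : t ≤ 1 / 4) (htN : 1 ≤ t * N) :
    P {ω | ¬ LimitRatioAtLeast (h ω) x
        ((1 - 4 * t) * √((N + ((m : ℝ) + 1)) / ((m : ℝ) + 1)))} ≤
      ENNReal.ofReal (3 * (sqGaussianVariance / (t ^ 2 * N))) := by
  have hNpos : (0 : ℝ) < N := by
    by_contra! hN0
    nlinarith
  have hm0 : (0 : ℝ) < (m : ℝ) + 1 := by positivity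
  have hC := sqGaussianVariance_nonneg
  have hrow : ∀ ω i, ‖jacobianRow (h ω) x i‖ ^ 2 = ∑ j, jacobian (h ω) x i j ^ 2 :=
    fun ω i ↦ EuclideanSpace.real_norm_sq_eq _
  set q := sqGaussianVariance / (t ^ 2 * N) with hq
  have hq0 : 0 ≤ q := by positivity
  have h1 : P {ω | t * (N * ((m : ℝ) + 1)) ≤
      |∑ i, ‖jacobianRow (h ω) x i‖ ^ 2 - N * ((m : ℝ) + 1)|} ≤ ENNReal.ofReal q := by
    have := measure_abs_sum_sq_sub_card_ge_le (fun p : Fin (m + 1) × Fin N ↦ hlaw p.1 p.2) hind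
      (c := t * (N * ((m : ℝ) + 1))) (by positivity)
    simp only [Fintype.card_prod, Fintype.card_fin, Fintype.sum_prod_type, ← hrow,
      Nat.cast_mul, Nat.cast_add, Nat.cast_one, mul_comm ((m : ℝ) + 1) (N : ℝ)] at this
    refine this.trans (ENNReal.ofReal_le_ofReal ?_)
    rw [hq, div_le_div_iff₀ (by positivity) (by positivity)]
    have : (N * ((m : ℝ) + 1)) * sqGaussianVariance * (t ^ 2 * N) * 1 ≤
        (N * ((m : ℝ) + 1)) * sqGaussianVariance * (t ^ 2 * N) * ((m : ℝ) + 1) := by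
      gcongr; linarith [(Nat.cast_nonneg m : (0 : ℝ) ≤ m)]
    linarith
  have h2 : P {ω | t * N ≤ |‖jacobianRow (h ω) x 0‖ ^ 2 - N|} ≤ ENNReal.ofReal q := by
    have := measure_abs_sum_sq_sub_card_ge_le (hlaw 0)
      (hind.precomp (g := fun j ↦ (0, j)) (Prod.mk_right_injective 0))
      (c := t * N) (by positivity)
    simp only [Fintype.card_fin, ← hrow] at this
    refine this.trans (ENNReal.ofReal_le_ofReal (le_of_eq ?_))
    rw [hq]; field_simp
  have h3 : P {ω | ∑ i : Fin m, (inner ℝ (jacobianRow (h ω) x i.succ) (jacobianRow (h ω) x 0)) ^ 2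
      < (m - t * (N + ((m : ℝ) + 1))) * ‖jacobianRow (h ω) x 0‖ ^ 2} ≤ ENNReal.ofReal q := by
    have hR := hasLaw_gaussianRows (fun p : Fin (m + 1) × Fin N ↦ hlaw p.1 p.2) hind
    have hmeas : MeasurableSet {a : Fin (m + 1) → EuclideanSpace ℝ (Fin N) |
        ∑ i : Fin m, (inner ℝ (a i.succ) (a 0)) ^ 2
          < (m - t * (N + ((m : ℝ) + 1))) * ‖a 0‖ ^ 2} :=
      measurableSet_lt (by fun_prop) (by fun_prop)
    have he := hR.measure_eq hmeas
    refine (he.le.trans (gaussianRows_inner_row_zero_sq_le (by positivity))).trans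
      (ENNReal.ofReal_le_ofReal ?_)
    rw [hq, div_le_div_iff₀ (by positivity) (by positivity)]
    -- The slack `t(N + m + 1)`, rather than `t * m`, keeps the bound uniform: `m * N ≤ (N + m +
    -- 1)²` for every `m`.
    have : sqGaussianVariance * t ^ 2 * (m * N) ≤
        sqGaussianVariance * t ^ 2 * (N + ((m : ℝ) + 1)) ^ 2 := by
      gcongr
      nlinarith [(Nat.cast_nonneg m : (0 : ℝ) ≤ m)]
    linarith
  have hsub : {ω | ¬ LimitRatioAtLeast (h ω) x
        ((1 - 4 * t) * √((N + ((m : ℝ) + 1)) / ((m : ℝ) + 1)))} ≤ᵐ[P]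
      ({ω | t * (N * ((m : ℝ) + 1)) ≤
          |∑ i, ‖jacobianRow (h ω) x i‖ ^ 2 - N * ((m : ℝ) + 1)|} ∪
        {ω | t * N ≤ |‖jacobianRow (h ω) x 0‖ ^ 2 - N|} ∪
        {ω | ∑ i : Fin m, (inner ℝ (jacobianRow (h ω) x i.succ) (jacobianRow (h ω) x 0)) ^ 2
          < (m - t * (N + ((m : ℝ) + 1))) * ‖jacobianRow (h ω) x 0‖ ^ 2} : Set Ω) := by
    filter_upwards [hdm] with ω hω
    change ¬ _ → (_ ∨ _) ∨ _
    refine fun hbad ↦ by_contra fun hgood ↦ hbad ?_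
    rw [not_or, not_or] at hgood
    obtain ⟨⟨g1, g2⟩, g3⟩ := hgood
    rw [Set.mem_ofPred_eq] at g1 g2 g3
    have g1 := abs_lt.1 (not_le.1 g1)
    have g2 := abs_lt.1 (not_le.1 g2)
    have g3 := not_lt.1 g3
    exact limitRatioAtLeast_of_row_bounds hω.1 hω.2 ht0 ht1 htN (by linarith) (by linarith) g3
  calc _ ≤ _ := measure_mono_ae hsub
    _ ≤ ENNReal.ofReal q + ENNReal.ofReal q + ENNReal.ofReal q :=
      (measure_union_le _ _).trans (add_le_add ((measure_union_le _ _).trans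
        (add_le_add h1 h2)) h3)
    _ = _ := by
      rw [← ENNReal.ofReal_add hq0 hq0, ← ENNReal.ofReal_add (by positivity) hq0]
      congr 1; ring

theorem mainTheorem2 :
    (∀ (N M : ℕ) (h : EuclideanSpace ℝ (Fin N) → EuclideanSpace ℝ (Fin M))
        (x : EuclideanSpace ℝ (Fin N)),
        DifferentiableAt ℝ h x → MeasurableChange h x → jacobian h x ≠ 0 →
        LimitRatioAtLeast h x (Real.sqrt ((N : ℝ) / (M : ℝ)))) ∧
    (∀ δ : ℝ, 0 < δ → ∀ η : ℝ, 0 < η → ∃ N₀ : ℕ, ∀ N : ℕ, N₀ ≤ N → ∀ M : ℕ, 1 ≤ M →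
        ∀ (Ω : Type*) [MeasurableSpace Ω] (P : Measure Ω) [IsProbabilityMeasure P]
          (h : Ω → EuclideanSpace ℝ (Fin N) → EuclideanSpace ℝ (Fin M))
          (x : EuclideanSpace ℝ (Fin N)),
        (∀ᵐ ω ∂P, DifferentiableAt ℝ (h ω) x ∧ MeasurableChange (h ω) x) →
        (∀ (i : Fin M) (j : Fin N),
          HasLaw (fun ω ↦ jacobian (h ω) x i j) (gaussianReal 0 1) P) →
        iIndepFun (fun (p : Fin M × Fin N) (ω : Ω) ↦ jacobian (h ω) x p.1 p.2) P →
        P {ω | ¬ LimitRatioAtLeast (h ω) x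
            ((1 - δ) * Real.sqrt (((N : ℝ) + (M : ℝ)) / (M : ℝ)))} ≤ ENNReal.ofReal η) := by
  refine ⟨fun N M h x hd hm hJ ↦ limitRatioAtLeast_sqrt_div hd hm hJ, fun δ hδ η hη ↦ ?_⟩
  set t : ℝ := min δ 1 / 4 with ht
  have ht0 : 0 < t := by positivity
  have ht1 : t ≤ 1 / 4 := by linarith [min_le_right δ 1]
  have htδ : 4 * t ≤ δ := by linarith [min_le_left δ 1]
  -- The first term ensures `1 ≤ t * N`, the second that the total failure probability is at most
  -- `η`.
  obtain ⟨N₀, hN₀⟩ := exists_nat_ge (max (1 / t) (3 * sqGaussianVariance / (t ^ 2 * η)))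
  refine ⟨N₀, fun N hN M hM Ω _ P _ h x hdm hlaw hind ↦ ?_⟩
  obtain ⟨m, rfl⟩ : ∃ m, M = m + 1 := ⟨M - 1, by omega⟩
  have hNr : max (1 / t) (3 * sqGaussianVariance / (t ^ 2 * η)) ≤ N :=
    hN₀.trans (by exact_mod_cast hN)
  have htN : 1 ≤ t * N := by
    have := (le_max_left _ _).trans hNr
    rwa [div_le_iff₀' ht0] at this
  have hNpos : (0 : ℝ) < N := by
    by_contra! hN0
    nlinarith
  refine (measure_mono (Set.ofPred_subset_ofPred.2 fun ω ↦ mt fun hgood ↦ ?_)).trans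
    ((measure_not_limitRatioAtLeast_le hdm hlaw hind ht0 ht1 htN).trans
      (ENNReal.ofReal_le_ofReal ?_))
  · refine hgood.mono ?_
    push_cast
    gcongr
  · have := (le_max_right _ _).trans hNr
    rw [div_le_iff₀ (by positivity)] at this
    rw [← mul_div_assoc, div_le_iff₀ (by positivity)]
    linarith
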